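/- Theorem 4.1. Let $T>0$, $A\in\mathbb{R}^{n\times n}$, $B\in\mathbb{R}^{n\times 1}$ and $\xi\in\mathbb{R}^n$. A control is a real-valued $u\in L^\infty[0,T]$ (functions that agree almost everywhere are identified). It is admissible for $\xi$ if $\|u\|_\infty\le 1$ and the solution of $\dot x(t)=Ax(t)+Bu(t)$, $x(0)=\xi$, satisfies $x(T)=0$; let $U(\xi)$ be the set of admissible controls. Let $\|u\|_1=\int_0^T|u(t)|\,dt$ and $\|u\|_0=m(\operatorname{supp}u)$, where $m$ is Lebesgue measure and $\operatorname{supp}u$ is the closed support of $u$, i.e. the set of all $t\in[0,T]$ such that $\{s\in N\cap[0,T]: u(s)\neq 0\}$ has positive measure for every neighbourhood $N$ of $t$ (equivalently, the smallest of the sets $\overline{\{s\in[0,T]:v(s)\ne0\}}$ over all representatives $v$ of $u$). Let $U_0^*(\xi)$ (the sparse optimal controls) and $U_1^*(\xi)$ (the $L^1$-optimal controls) be the sets of minimizers over $U(\xi)$ of $\|u\|_0$ and of $\|u\|_1$, respectively. The $L^1$-optimal control problem for $\xi$ is called normal if $m(\{t\in[0,T]:|B^{\mathrm T}p(t)|=1\})=0$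 for every $u\in U_1^*(\xi)$ and every costate $p$ that satisfies Pontryagin's minimum principle together with $u$, that is, every $p:[0,T]\to\mathbb{R}^n$ with $\dot p(t)=-A^{\mathrm T}p(t)$ on $[0,T]$ such that, for almost every $t\in[0,T]$ and all $w\in[-1,1]$, $$|u(t)|+p(t)^{\mathrm T}\bigl(Ax(t)+Bu(t)\bigr)\le |w|+p(t)^{\mathrm T}\bigl(Ax(t)+Bw\bigr),$$ where $x$ is the trajectory of $u$ starting at $\xi$. Assume that the $L^1$-optimal control problem for $\xi$ is normal and that $U_1^*(\xi)\neq\emptyset$. Then $U_0^*(\xi)=U_1^*(\xi)$, and $\|u_0\|_0=\|u_1\|_1$ for all $u_0\in U_0^*(\xi)$ and $u_1\in U_1^*(\xi)$. -/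

import Mathlib

open MeasureTheory Set
open scoped ENNReal Matrix Topology

noncomputable section

namespace SparseControl

/-- Lebesgue measure on the horizon `[0, T]`. -/
abbrev horizon (T : ℝ) : Measure ℝ := volume.restrict (Icc 0 T)

/-- Control signals on `[0, T]`: elements of `L^∞[0, T]`, that is, essentially bounded measurable
functions up to equality almost everywhere. -/
abbrev Signal (T : ℝ) : Type := Lp ℝ ∞ (horizon T)

variable {n : ℕ} {T : ℝ}

/-- The `L¹` norm of a signal. -/
def l1Norm (u : Signal T) : ℝ≥0∞ := eLpNorm u 1 (horizon T)

/-- The (closed) support of a signal, as an almost-everywhere class: the points `t` of `[0, T]`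
all of whose neighbourhoods meet `{s ∈ [0, T] | u s ≠ 0}` in a set of positive measure. It is the
smallest of the closed sets `closure {s ∈ [0, T] | v s ≠ 0}`, where `v` runs through the
representatives of `u`. -/
def signalSupport (u : Signal T) : Set ℝ :=
  {t | t ∈ Icc 0 T ∧ ∀ N ∈ 𝓝 t, 0 < volume {s | s ∈ N ∧ s ∈ Icc 0 T ∧ u s ≠ 0}}

/-- The `L⁰` norm of a signal: the Lebesgue measure of its closed support. -/
def l0Norm (u : Signal T) : ℝ≥0∞ := volume (signalSupport u)

/-- `x` is the trajectory on `[0, T]` of `dx/dt = A x + B u`, `x(0) = ξ` (in the sense of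
Carathéodory, that is, in integrated form). -/
structure IsTrajectory (A : Matrix (Fin n) (Fin n) ℝ) (B : Fin n → ℝ) (ξ : Fin n → ℝ)
    (u : Signal T) (x : ℝ → Fin n → ℝ) : Prop where
  continuousOn : ContinuousOn x (Icc 0 T)
  eq_integral : ∀ t ∈ Icc 0 T, x t = ξ + ∫ s in (0 : ℝ)..t, (A *ᵥ x s + u s • B)

/-- The admissible controls for the initial state `ξ`: `‖u‖_∞ ≤ 1` and `u` steers `ξ` to the
origin at time `T`. -/
def admissible (A : Matrix (Fin n) (Fin n) ℝ) (B : Fin n → ℝ) (T : ℝ) (ξ : Fin n → ℝ) :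
    Set (Signal T) :=
  {u | ‖u‖ ≤ 1 ∧ ∃ x : ℝ → Fin n → ℝ, IsTrajectory A B ξ u x ∧ x T = 0}

/-- The optimal solutions of the sparse optimal control problem `P₀`. -/
def sparseOptimal (A : Matrix (Fin n) (Fin n) ℝ) (B : Fin n → ℝ) (T : ℝ) (ξ : Fin n → ℝ) :
    Set (Signal T) :=
  {u | u ∈ admissible A B T ξ ∧ ∀ v ∈ admissible A B T ξ, l0Norm u ≤ l0Norm v}

/-- The optimal solutions of the `L¹`-optimal control problem `P₁`. -/
def l1Optimal (A : Matrix (Fin n) (Fin n) ℝ) (B : Fin n → ℝ) (T : ℝ) (ξ : Fin n → ℝ) :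
    Set (Signal T) :=
  {u | u ∈ admissible A B T ξ ∧ ∀ v ∈ admissible A B T ξ, l1Norm u ≤ l1Norm v}

/-- The Hamiltonian `H(x, p, u) = |u| + pᵀ (A x + B u)` of the problem `P₁`. -/
def hamiltonian (A : Matrix (Fin n) (Fin n) ℝ) (B : Fin n → ℝ) (x p : Fin n → ℝ) (w : ℝ) : ℝ :=
  |w| + p ⬝ᵥ (A *ᵥ x + w • B)

/-- The conditions of Pontryagin's minimum principle for the problem `P₁`: `x` is the trajectory
of `u` from `ξ` to `0`, the costate `p` solves the adjoint equation on `[0, T]`, and at almost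
every time the control value minimizes the Hamiltonian over all values in `[-1, 1]`. -/
structure MinimumPrinciple (A : Matrix (Fin n) (Fin n) ℝ) (B : Fin n → ℝ) (ξ : Fin n → ℝ)
    (u : Signal T) (x p : ℝ → Fin n → ℝ) : Prop where
  trajectory : IsTrajectory A B ξ u x
  final : x T = 0
  adjoint : ∀ t ∈ Icc 0 T, HasDerivWithinAt p (-(Aᵀ *ᵥ p t)) (Icc 0 T) t
  minimum : ∀ᵐ t ∂(horizon T), ∀ w : ℝ, |w| ≤ 1 →
    hamiltonian A B (x t) (p t) (u t) ≤ hamiltonian A B (x t) (p t) w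

/-- Normality of `P₁` for the initial state `ξ`: for every `L¹`-optimal control and every costate
that the minimum principle allows for it, `{t ∈ [0, T] | |Bᵀ p(t)| = 1}` has measure zero. -/
def IsNormal (A : Matrix (Fin n) (Fin n) ℝ) (B : Fin n → ℝ) (T : ℝ) (ξ : Fin n → ℝ) : Prop :=
  ∀ u ∈ l1Optimal A B T ξ, ∀ x p : ℝ → Fin n → ℝ, MinimumPrinciple A B ξ u x p →
    volume {t | t ∈ Icc 0 T ∧ |B ⬝ᵥ p t| = 1} = 0

end SparseControl

end

/-! If `‖u‖ ≤ 1`, then `l1Norm u ≤ l0Norm u`, since `u` vanishes a.e. off its support. For an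
L¹-optimal `u` the reverse inequality also holds, so the two minima coincide and so do the
minimizers. For the reverse inequality, a costate must be produced. By duality, `x T = 0` amounts to
finitely many linear moment conditions on `u`, so P₁ is a convex problem on the unit ball of L^∞.
Hahn–Banach separation gives multipliers `q` for the moments and `c ≥ 0` for the cost, and the
resulting maximum condition localizes in time. If `c > 0`, then `-q/c` starts a Pontryagin costate
`p`: a.e. `u = 0` where `|Bᵀp| < 1` and `|u| = 1` where `|Bᵀp| > 1`. By normality, the closed set
`|Bᵀp| ≥ 1` contains the support and has measure at most `l1Norm u`. If `c = 0`, the switching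
function is analytic and not identically zero, so `|u| = 1` a.e. and normality is not needed. -/

namespace SparseControl

variable {n : ℕ} {T : ℝ}

/-! ### Linear flow, costates and switching functions -/

/-- Multiplication by a square matrix as a continuous linear map. -/
noncomputable def mulVecCLM (A : Matrix (Fin n) (Fin n) ℝ) : (Fin n → ℝ) →L[ℝ] (Fin n → ℝ) :=
  LinearMap.toContinuousLinearMap (Matrix.toLin' A)

@[simp]
lemma mulVecCLM_apply (A : Matrix (Fin n) (Fin n) ℝ) (v : Fin n → ℝ) :
    mulVecCLM A v = A *ᵥ v := rfl

/-- The flow at time `t` of the linear system `dx/dt = A x`. -/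
noncomputable def flow (A : Matrix (Fin n) (Fin n) ℝ) (t : ℝ) :
    (Fin n → ℝ) →L[ℝ] (Fin n → ℝ) :=
  NormedSpace.exp (t • mulVecCLM A)

lemma flow_zero (A : Matrix (Fin n) (Fin n) ℝ) : flow A 0 = 1 := by
  simp [flow]

lemma hasDerivAt_flow (A : Matrix (Fin n) (Fin n) ℝ) (t : ℝ) :
    HasDerivAt (flow A) (mulVecCLM A * flow A t) t :=
  hasDerivAt_exp_smul_const' (𝕂 := ℝ) (mulVecCLM A) t

lemma hasDerivAt_flow_apply (A : Matrix (Fin n) (Fin n) ℝ) (v : Fin n → ℝ) (t : ℝ) :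
    HasDerivAt (fun t ↦ flow A t v) (A *ᵥ flow A t v) t := by
  simpa using (hasDerivAt_flow A t).clm_apply (hasDerivAt_const t v)

lemma continuous_flow (A : Matrix (Fin n) (Fin n) ℝ) : Continuous (flow A) :=
  continuous_iff_continuousAt.2 fun t ↦ (hasDerivAt_flow A t).continuousAt

lemma flow_mul_flow_neg (A : Matrix (Fin n) (Fin n) ℝ) (t : ℝ) : flow A t * flow A (-t) = 1 := by
  have hc : Commute (t • mulVecCLM A) (-t • mulVecCLM A) :=
    ((Commute.refl (mulVecCLM A)).smul_left t).smul_right (-t)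
  have h0 : t • mulVecCLM A + -t • mulVecCLM A = 0 := by module
  let _ : NormedAlgebra ℚ ((Fin n → ℝ) →L[ℝ] (Fin n → ℝ)) := NormedAlgebra.restrictScalars ℚ ℝ _
  rw [flow, flow, ← NormedSpace.exp_add_of_commute hc, h0]
  exact NormedSpace.exp_zero

lemma flow_surjective (A : Matrix (Fin n) (Fin n) ℝ) (t : ℝ) :
    Function.Surjective (flow A t) := fun v ↦
  ⟨flow A (-t) v, by simpa using congrArg (fun f ↦ f v) (flow_mul_flow_neg A t)⟩

lemma analyticOnNhd_flow (A : Matrix (Fin n) (Fin n) ℝ) : AnalyticOnNhd ℝ (flow A) univ := by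
  intro t _
  exact (NormedSpace.exp_analytic (𝕂 := ℝ) (t • mulVecCLM A)).comp_of_eq
    (f := fun s : ℝ ↦ s • mulVecCLM A) (analyticAt_id.smul analyticAt_const) rfl

/-- The solution of the adjoint equation `dp/dt = -Aᵀ p` with `p(0) = q`. -/
noncomputable def costate (A : Matrix (Fin n) (Fin n) ℝ) (q : Fin n → ℝ) (t : ℝ) : Fin n → ℝ :=
  flow (-Aᵀ) t q

/-- The switching function `Bᵀ p` of the costate with `p(0) = q`. -/
noncomputable def switching (A : Matrix (Fin n) (Fin n) ℝ) (B q : Fin n → ℝ) (t : ℝ) : ℝ :=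
  B ⬝ᵥ costate A q t

variable (A : Matrix (Fin n) (Fin n) ℝ) (B : Fin n → ℝ)

lemma hasDerivAt_costate (q : Fin n → ℝ) (t : ℝ) :
    HasDerivAt (costate A q) (-(Aᵀ *ᵥ costate A q t)) t := by
  have h := hasDerivAt_flow_apply (-Aᵀ) q t
  rwa [Matrix.neg_mulVec] at h

lemma contDiff_costate (q : Fin n → ℝ) : ContDiff ℝ 1 (costate A q) := by
  have hd : deriv (costate A q) = fun t ↦ -(mulVecCLM Aᵀ (costate A q t)) :=
    funext fun t ↦ (hasDerivAt_costate A q t).deriv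
  have hdiff : Differentiable ℝ (costate A q) :=
    fun t ↦ (hasDerivAt_costate A q t).differentiableAt
  refine contDiff_one_iff_deriv.2 ⟨hdiff, ?_⟩
  rw [hd]
  exact ((mulVecCLM Aᵀ).continuous.comp hdiff.continuous).neg

lemma continuous_switching (q : Fin n → ℝ) : Continuous (switching A B q) :=
  continuous_const.dotProduct (contDiff_costate A q).continuous

lemma analyticOnNhd_switching (q : Fin n → ℝ) : AnalyticOnNhd ℝ (switching A B q) univ := by
  intro t _
  have h : switching A B q = fun t ↦ ∑ i, B i * flow (-Aᵀ) t q i := rfl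
  rw [h]
  refine Finset.analyticAt_fun_sum _ fun i _ ↦ analyticAt_const.mul ?_
  exact (((ContinuousLinearMap.proj (R := ℝ) (φ := fun _ : Fin n ↦ ℝ) i).comp
    (ContinuousLinearMap.apply ℝ (Fin n → ℝ) q)).analyticAt _).comp (analyticOnNhd_flow (-Aᵀ) t trivial)

/-- A nontrivial analytic function on the line has a discrete, hence null, zero set. This settles
the degenerate case `c = 0`. -/
lemma ae_switching_ne_zero {q : Fin n → ℝ} {t₀ : ℝ} (h : switching A B q t₀ ≠ 0) :
    ∀ᵐ t, switching A B q t ≠ 0 := by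
  have := (analyticOnNhd_switching A B q).preimage_zero_mem_codiscrete h
  have h2 := ae_restrict_le_codiscreteWithin (μ := (volume : Measure ℝ)) MeasurableSet.univ this
  rw [Measure.restrict_univ] at h2
  exact h2

lemma switching_sum (q : Fin n → ℝ) (t : ℝ) :
    switching A B q t = ∑ i, q i * switching A B (Pi.single i 1) t := by
  have : q = ∑ i, q i • (Pi.single i 1 : Fin n → ℝ) := pi_eq_sum_univ' q
  conv_lhs => rw [this]
  simp [switching, costate, dotProduct_sum, dotProduct_smul]

/-! ### Trajectories and their duality with costates -/

lemma intervalIntegrable_smul_const {f : ℝ → ℝ} {a b : ℝ} (hf : IntervalIntegrable f volume a b) :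
    IntervalIntegrable (fun t ↦ f t • B) volume a b :=
  ⟨hf.1.smul_const B, hf.2.smul_const B⟩

/-- Integration by parts of a continuously differentiable function against a primitive. -/
lemma integral_deriv_mul_primitive {p g : ℝ → ℝ} (hp : ContDiff ℝ 1 p) {a b : ℝ}
    (hg : IntervalIntegrable g volume a b) (c : ℝ) :
    ∫ t in a..b, (deriv p t * (c + ∫ s in a..t, g s) + p t * g t) =
      p b * (c + ∫ s in a..b, g s) - p a * c := by
  have hpac : AbsolutelyContinuousOnInterval p a b :=
    hp.contDiffOn.absolutelyContinuousOnInterval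
  have hcac : AbsolutelyContinuousOnInterval (fun _ : ℝ ↦ c) a b :=
    (contDiff_const (n := 1)).contDiffOn.absolutelyContinuousOnInterval
  have hgac : AbsolutelyContinuousOnInterval (fun t ↦ c + ∫ s in a..t, g s) a b :=
    hcac.add (hg.absolutelyContinuousOnInterval_intervalIntegral (c := a) (by simp))
  have h := hpac.integral_deriv_mul_eq_sub hgac
  simp only [intervalIntegral.integral_same, add_zero] at h
  rw [← h]
  refine intervalIntegral.integral_congr_ae ?_
  filter_upwards [hg.ae_hasDerivAt_integral] with t ht ht'
  rw [((ht (uIoc_subset_uIcc ht') a (by simp)).const_add c).deriv]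

lemma intervalIntegrable_signal (hT : 0 ≤ T) (u : Signal T) :
    IntervalIntegrable (fun t ↦ u t) volume 0 T := by
  rw [intervalIntegrable_iff_integrableOn_Icc_of_le hT]
  exact (Lp.memLp u).integrable (by simp)

lemma IsTrajectory.intervalIntegrable {A : Matrix (Fin n) (Fin n) ℝ} {B ξ : Fin n → ℝ}
    {u : Signal T} {x : ℝ → Fin n → ℝ} (hT : 0 ≤ T) (hx : IsTrajectory A B ξ u x) :
    IntervalIntegrable (fun s ↦ A *ᵥ x s + u s • B) volume 0 T := by
  refine IntervalIntegrable.add ?_ (intervalIntegrable_smul_const B (intervalIntegrable_signal hT u))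
  refine ContinuousOn.intervalIntegrable ?_
  rw [uIcc_of_le hT]
  exact (mulVecCLM A).continuous.comp_continuousOn hx.continuousOn

/-- Pairing a trajectory with a costate. -/
lemma IsTrajectory.costate_dotProduct {A : Matrix (Fin n) (Fin n) ℝ} {B ξ : Fin n → ℝ}
    {u : Signal T} {x : ℝ → Fin n → ℝ} (hT : 0 ≤ T) (hx : IsTrajectory A B ξ u x)
    (q : Fin n → ℝ) :
    costate A q T ⬝ᵥ x T - q ⬝ᵥ ξ = ∫ t in (0 : ℝ)..T, switching A B q t * u t := by
  have hint := hx.intervalIntegrable hT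
  set g : ℝ → Fin n → ℝ := fun s ↦ A *ᵥ x s + u s • B with hg
  have hgi (i : Fin n) : IntervalIntegrable (fun s ↦ g s i) volume 0 T :=
    ⟨hint.1.eval i, hint.2.eval i⟩
  have hxi (i : Fin n) {t : ℝ} (ht : t ∈ Icc 0 T) :
      x t i = ξ i + ∫ s in (0 : ℝ)..t, g s i := by
    have hint' : IntervalIntegrable g volume 0 t :=
      hint.mono_set (uIcc_subset_uIcc_left (by rwa [uIcc_of_le hT]))
    rw [hx.eq_integral t ht, Pi.add_apply, ← ContinuousLinearMap.proj_apply (R := ℝ) i (∫ s in _.._, _),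
      ← ContinuousLinearMap.intervalIntegral_comp_comm _ hint']
    rfl
  have hp (i : Fin n) : ContDiff ℝ 1 (fun t ↦ costate A q t i) :=
    contDiff_pi.1 (contDiff_costate A q) i
  have hpd (i : Fin n) (t : ℝ) :
      deriv (fun t ↦ costate A q t i) t = -(Aᵀ *ᵥ costate A q t) i :=
    (hasDerivAt_pi.1 (hasDerivAt_costate A q t) i).deriv
  have key (i : Fin n) := integral_deriv_mul_primitive (hp i) (hgi i) (ξ i)
  have hT' : T ∈ Icc 0 T := ⟨hT, le_rfl⟩
  have h0 : costate A q 0 = q := by simp [costate, flow_zero]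
  have hL : costate A q T ⬝ᵥ x T - q ⬝ᵥ ξ = ∑ i, (costate A q T i *
      (ξ i + ∫ s in (0 : ℝ)..T, g s i) - costate A q 0 i * ξ i) := by
    simp only [dotProduct, h0, ← hxi _ hT', Finset.sum_sub_distrib]
  rw [hL, ← Finset.sum_congr rfl fun i _ ↦ key i, ← intervalIntegral.integral_finsetSum]
  · refine intervalIntegral.integral_congr fun t ht ↦ ?_
    rw [uIcc_of_le hT] at ht
    simp only [hpd, ← hxi _ ht]
    rw [Finset.sum_add_distrib]
    change (-(Aᵀ *ᵥ costate A q t)) ⬝ᵥ x t + costate A q t ⬝ᵥ (A *ᵥ x t + u t • B) = _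
    -- The adjoint equation makes the two terms containing `A` cancel.
    rw [neg_dotProduct, dotProduct_add, Matrix.mulVec_transpose, Matrix.dotProduct_mulVec,
      dotProduct_smul, smul_eq_mul, switching, dotProduct_comm B]
    ring
  · intro i _
    refine IntervalIntegrable.add ?_ ((hgi i).continuousOn_mul (hp i).continuous.continuousOn)
    refine ContinuousOn.intervalIntegrable ?_
    refine ((hp i).continuous_deriv le_rfl).continuousOn.mul ?_
    refine ContinuousOn.congr (f := fun t ↦ x t i) ?_ fun t ht ↦ ?_
    · rw [uIcc_of_le hT]
      exact (continuous_apply i).comp_continuousOn hx.continuousOn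
    · rw [uIcc_of_le hT] at ht
      exact (hxi i ht).symm

/-- Every control has a trajectory. -/
lemma exists_isTrajectory (hT : 0 ≤ T) (ξ : Fin n → ℝ) (u : Signal T) :
    ∃ x, IsTrajectory A B ξ u x := by
  -- Subtracting `V t • B` from the trajectory leaves the classical equation `y' = A (y + V B)` with
  -- continuous forcing, solved by variation of constants.
  set V : ℝ → ℝ := fun t ↦ ∫ s in (0 : ℝ)..t, (Icc 0 T).indicator u s with hV
  have hind : Integrable ((Icc 0 T).indicator u) :=
    (integrable_indicator_iff measurableSet_Icc).2 ((Lp.memLp u).integrable (by simp))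
  have hVc : Continuous V := intervalIntegral.continuous_primitive
    (fun a b ↦ hind.intervalIntegrable) 0
  have hVu {t : ℝ} (ht : t ∈ Icc 0 T) : V t = ∫ s in (0 : ℝ)..t, u s := by
    refine intervalIntegral.integral_congr fun s hs ↦ ?_
    rw [uIcc_of_le ht.1] at hs
    exact indicator_of_mem (show s ∈ Icc 0 T from ⟨hs.1, hs.2.trans ht.2⟩) _
  set k : ℝ → Fin n → ℝ := fun s ↦ flow A (-s) (V s • A *ᵥ B) with hk
  have hkc : Continuous k :=
    ((continuous_flow A).comp continuous_neg).clm_apply (hVc.smul continuous_const)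
  set y : ℝ → Fin n → ℝ := fun t ↦ flow A t (ξ + ∫ s in (0 : ℝ)..t, k s) with hy
  have hyd (t : ℝ) : HasDerivAt y (A *ᵥ (y t + V t • B)) t := by
    have h1 : HasDerivAt (fun t ↦ ξ + ∫ s in (0 : ℝ)..t, k s) (k t) t :=
      (hkc.integral_hasStrictDerivAt 0 t).hasDerivAt.const_add ξ
    have h2 := (hasDerivAt_flow A t).clm_apply h1
    have h3 : flow A t (k t) = V t • A *ᵥ B :=
      congrArg (fun f ↦ f (V t • A *ᵥ B)) (flow_mul_flow_neg A t)
    rw [h3] at h2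
    have h4 : A *ᵥ (y t + V t • B) =
        (mulVecCLM A * flow A t) (ξ + ∫ s in (0 : ℝ)..t, k s) + V t • A *ᵥ B := by
      rw [Matrix.mulVec_add, Matrix.mulVec_smul]
      rfl
    rw [h4]
    exact h2
  have hyc : Continuous y := continuous_iff_continuousAt.2 fun t ↦ (hyd t).continuousAt
  have hxc : Continuous fun t ↦ y t + V t • B := hyc.add (hVc.smul continuous_const)
  refine ⟨fun t ↦ y t + V t • B, hxc.continuousOn, fun t ht ↦ ?_⟩
  have hi1 : IntervalIntegrable (fun s ↦ A *ᵥ (y s + V s • B)) volume 0 t :=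
    ((mulVecCLM A).continuous.comp hxc).intervalIntegrable _ _
  have hi2 : IntervalIntegrable (fun s ↦ u s • B) volume 0 t :=
    (intervalIntegrable_smul_const B (intervalIntegrable_signal hT u)).mono_set
      (uIcc_subset_uIcc_left (by rwa [uIcc_of_le hT]))
  rw [intervalIntegral.integral_add hi1 hi2, intervalIntegral.integral_smul_const, ← hVu ht,
    intervalIntegral.integral_eq_sub_of_hasDerivAt (fun s _ ↦ hyd s) hi1]
  simp [hy, flow_zero]
  abel

/-- A control of norm at most one with the same switching moments as an admissible control is
admissible. -/
lemma admissible_of_moments_eq {A : Matrix (Fin n) (Fin n) ℝ} {B ξ : Fin n → ℝ} (hT : 0 ≤ T)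
    {u v : Signal T} (hu : u ∈ admissible A B T ξ) (hv : ‖v‖ ≤ 1)
    (h : ∀ q, ∫ t in (0 : ℝ)..T, switching A B q t * v t =
      ∫ t in (0 : ℝ)..T, switching A B q t * u t) :
    v ∈ admissible A B T ξ := by
  obtain ⟨-, x, hx, hxT⟩ := hu
  obtain ⟨y, hy⟩ := exists_isTrajectory A B hT ξ v
  refine ⟨hv, y, hy, ?_⟩
  -- Terminal costates fill the whole space, so pairing with them detects the terminal state.
  refine dotProduct_eq_zero _ fun w ↦ ?_
  obtain ⟨q, rfl⟩ := flow_surjective (-Aᵀ) T w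
  have h1 := hx.costate_dotProduct hT q
  have h2 := hy.costate_dotProduct hT q
  rw [h q, ← h1, hxT, dotProduct_zero, sub_left_inj, dotProduct_comm] at h2
  exact h2

/-! ### Convex multiplier rule by separation -/

/-- The Lagrange multiplier rule (with a multiplier for the cost that may vanish) for a convex cost
on the unit ball under finitely many linear constraints. -/
lemma exists_multiplier {E ι : Type*} [NormedAddCommGroup E] [NormedSpace ℝ E] [Fintype ι]
    (L : ι → E →ₗ[ℝ] ℝ) {φ : E → ℝ} (hφ : ConvexOn ℝ univ φ) (hφc : Continuous φ) {u : E}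
    (hmin : ∀ v, ‖v‖ ≤ 1 → (∀ i, L i v = L i u) → φ u ≤ φ v) :
    ∃ (c : ℝ) (q : ι → ℝ), 0 ≤ c ∧ (c = 0 → ∑ i, q i * L i u ≠ 0) ∧
      ∀ v, ‖v‖ ≤ 1 → ∑ i, q i * L i v - c * φ v ≤ ∑ i, q i * L i u - c * φ u := by
  -- Optimality of `u` says that the open strict epigraph `D₁` misses the convex set `D₂`.
  set D₁ : Set (E × ℝ) := {z | ‖z.1‖ < 1 ∧ φ z.1 < z.2}
  set D₂ : Set (E × ℝ) := {z | (∀ i, L i z.1 = L i u) ∧ z.2 ≤ φ u}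
  have hD₁ : Convex ℝ D₁ := by
    have h1 : Convex ℝ ((LinearMap.fst ℝ E ℝ) ⁻¹' Metric.ball 0 1) :=
      (convex_ball 0 1).linear_preimage _
    convert h1.inter hφ.convex_strict_epigraph using 1
    ext z
    simp [D₁]
  have hD₁o : IsOpen D₁ :=
    (isOpen_lt continuous_fst.norm continuous_const).inter
      (isOpen_lt (hφc.comp continuous_fst) continuous_snd)
  have hD₂ : Convex ℝ D₂ := by
    rintro z ⟨hz1, hz2⟩ w ⟨hw1, hw2⟩ a b ha hb hab
    refine ⟨fun i ↦ ?_, ?_⟩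
    · simp [hz1 i, hw1 i, ← add_mul, hab]
    · calc a * z.2 + b * w.2 ≤ a * φ u + b * φ u := by gcongr
        _ = φ u := by rw [← add_mul, hab, one_mul]
  have hdisj : Disjoint D₁ D₂ := by
    refine Set.disjoint_left.2 fun z hz1 hz2 ↦ ?_
    have := hmin z.1 hz1.1.le hz2.1
    linarith [hz1.2, hz2.2]
  obtain ⟨f, s, hf₁, hf₂⟩ := geometric_hahn_banach_open hD₁ hD₁o hD₂ hdisj
  set g : E →ₗ[ℝ] ℝ := (f : E × ℝ →ₗ[ℝ] ℝ) ∘ₗ LinearMap.inl ℝ E ℝ with hg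
  set c : ℝ := -f (0, 1) with hc
  have hf (v : E) (r : ℝ) : f (v, r) = g v - c * r := by
    have : (v, r) = (v, (0 : ℝ)) + r • ((0 : E), (1 : ℝ)) := by simp
    rw [this, map_add, map_smul, hc, smul_eq_mul]
    simp [hg]
    ring
  have hlow (v : E) (hv : ∀ i, L i v = L i u) (r : ℝ) (hr : r ≤ φ u) : s ≤ g v - c * r := by
    rw [← hf]
    exact hf₂ (v, r) ⟨hv, hr⟩
  have hup (v : E) (hv : ‖v‖ < 1) (r : ℝ) (hr : φ v < r) : g v - c * r < s := by
    rw [← hf]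
    exact hf₁ (v, r) ⟨hv, hr⟩
  have hc0 : 0 ≤ c := by
    by_contra! hneg
    have h0 := hlow u (fun _ ↦ rfl) (φ u) le_rfl
    set k := g u - c * φ u - s
    have h1 := hlow u (fun _ ↦ rfl) (φ u - (k + 1) / (-c))
      (by have : 0 ≤ (k + 1) / (-c) := div_nonneg (by linarith) (by linarith)
          linarith)
    have h2 : c * ((k + 1) / (-c)) = -(k + 1) := by
      rw [div_neg, mul_neg, mul_div_cancel₀ _ hneg.ne]
    rw [mul_sub, h2] at h1
    simp only [k] at h1
    linarith
  -- A direction in all kernels with `g w ≠ 0` would make the functional unbounded below on `D₂`;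
  -- the multiple of `w` chosen here reaches `s - 1`.
  have hker : ⨅ i, LinearMap.ker (L i) ≤ LinearMap.ker g := by
    intro w hw
    simp only [Submodule.mem_iInf, LinearMap.mem_ker] at hw ⊢
    by_contra hgw
    have h1 := hlow (u + ((s - 1 - (g u - c * φ u)) / g w) • w) (fun i ↦ by simp [hw i]) _ le_rfl
    rw [map_add, map_smul, smul_eq_mul, div_mul_cancel₀ _ hgw] at h1
    linarith
  obtain ⟨q, hq⟩ := (Submodule.mem_span_range_iff_exists_fun ℝ).1 (mem_span_of_iInf_ker_le_ker hker)
  have hgq (v : E) : ∑ i, q i * L i v = g v := by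
    rw [← hq]
    simp
  refine ⟨c, q, hc0, fun h0 ↦ ?_, fun v hv ↦ ?_⟩
  · have h1 := hup 0 (by simp) (φ 0 + 1) (by linarith)
    have h2 := hlow u (fun _ ↦ rfl) _ le_rfl
    simp only [h0, map_zero, zero_mul, sub_zero] at h1 h2
    rw [hgq]
    linarith
  · rw [hgq, hgq]
    refine le_trans ?_ (hlow u (fun _ ↦ rfl) _ le_rfl)
    -- Separation covers only the open ball and strict epigraph: shrink `v` by `l`, lift by `1 - l`,
    -- and let `l` tend to 1.
    have hlim : Filter.Tendsto (fun l : ℝ ↦ l * g v - c * (φ (l • v) + (1 - l))) (𝓝[<] 1)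
        (𝓝 (1 * g v - c * (φ ((1 : ℝ) • v) + (1 - 1)))) := by
      refine Filter.Tendsto.mono_left (Continuous.tendsto ?_ 1) nhdsWithin_le_nhds
      fun_prop
    rw [one_mul, one_smul, sub_self, add_zero] at hlim
    refine le_of_tendsto hlim ?_
    filter_upwards [Ioo_mem_nhdsLT (zero_lt_one' ℝ)] with l hl
    have hlv : ‖l • v‖ < 1 := by
      rw [norm_smul, Real.norm_of_nonneg hl.1.le]
      exact (mul_le_of_le_one_right hl.1.le hv).trans_lt hl.2
    have := hup (l • v) hlv (φ (l • v) + (1 - l)) (by linarith [hl.2])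
    rw [map_smul, smul_eq_mul] at this
    exact this.le

/-! ### Moments and L¹ cost on signals -/

lemma integrable_signal (u : Signal T) : Integrable (fun t ↦ u t) (horizon T) :=
  (Lp.memLp u).integrable (by simp)

lemma integrable_mul_signal {h : ℝ → ℝ} (hh : Continuous h) (u : Signal T) :
    Integrable (fun t ↦ h t * u t) (horizon T) :=
  IntegrableOn.continuousOn_mul hh.continuousOn (integrable_signal u) isCompact_Icc

lemma ae_abs_le_norm (u : Signal T) : ∀ᵐ t ∂(horizon T), |u t| ≤ ‖u‖ := by
  filter_upwards [ae_le_eLpNormEssSup (f := u) (μ := horizon T)] with t ht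
  rw [← eLpNorm_exponent_top, ← Lp.enorm_def] at ht
  rwa [enorm_le_iff_norm_le, Real.norm_eq_abs] at ht

lemma norm_le_one_of_ae {u : Signal T} (h : ∀ᵐ t ∂(horizon T), |u t| ≤ 1) : ‖u‖ ≤ 1 := by
  have h' : ∀ᵐ t ∂(horizon T), ‖u t‖ ≤ 1 := h
  simpa using Lp.norm_le_of_ae_bound zero_le_one h'

/-- The linear functional `v ↦ ∫ h v` on signals. -/
noncomputable def moment (T : ℝ) {h : ℝ → ℝ} (hh : Continuous h) : Signal T →ₗ[ℝ] ℝ where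
  toFun v := ∫ t, h t * v t ∂(horizon T)
  map_add' v w := by
    rw [← integral_add (integrable_mul_signal hh v) (integrable_mul_signal hh w)]
    refine integral_congr_ae ?_
    filter_upwards [Lp.coeFn_add v w] with t ht
    rw [ht, Pi.add_apply, mul_add]
  map_smul' r v := by
    rw [RingHom.id_apply, smul_eq_mul, ← integral_const_mul]
    refine integral_congr_ae ?_
    filter_upwards [Lp.coeFn_smul r v] with t ht
    rw [ht, Pi.smul_apply, smul_eq_mul, mul_left_comm]

lemma moment_apply {h : ℝ → ℝ} (hh : Continuous h) (v : Signal T) :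
    moment T hh v = ∫ t, h t * v t ∂(horizon T) := rfl

lemma integral_horizon (hT : 0 ≤ T) (f : ℝ → ℝ) :
    ∫ t in (0 : ℝ)..T, f t = ∫ t, f t ∂(horizon T) := by
  rw [intervalIntegral.integral_of_le hT, integral_Icc_eq_integral_Ioc]

/-- The real-valued `L¹` norm of a signal. -/
noncomputable def l1Cost (u : Signal T) : ℝ := ∫ t, |u t| ∂(horizon T)

lemma l1Norm_eq_ofReal (u : Signal T) : l1Norm u = ENNReal.ofReal (l1Cost u) := by
  rw [l1Norm, eLpNorm_one_eq_lintegral_enorm,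
    ← ofReal_integral_norm_eq_lintegral_enorm (integrable_signal u)]
  rfl

lemma l1Cost_nonneg (u : Signal T) : 0 ≤ l1Cost u := integral_nonneg fun _ ↦ abs_nonneg _

lemma l1Norm_le_iff {u v : Signal T} : l1Norm u ≤ l1Norm v ↔ l1Cost u ≤ l1Cost v := by
  rw [l1Norm_eq_ofReal, l1Norm_eq_ofReal, ENNReal.ofReal_le_ofReal_iff (l1Cost_nonneg v)]

lemma convexOn_l1Cost : ConvexOn ℝ univ (l1Cost : Signal T → ℝ) := by
  refine ⟨convex_univ, fun u _ v _ a b ha hb _ ↦ ?_⟩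
  simp only [l1Cost, smul_eq_mul]
  rw [← integral_const_mul, ← integral_const_mul, ← integral_add
    ((integrable_signal u).abs.const_mul a) ((integrable_signal v).abs.const_mul b)]
  refine integral_mono_ae (integrable_signal _).abs
    (((integrable_signal u).abs.const_mul a).add ((integrable_signal v).abs.const_mul b)) ?_
  filter_upwards [Lp.coeFn_add (a • u) (b • v), Lp.coeFn_smul a u, Lp.coeFn_smul b v]
    with t h1 h2 h3
  rw [h1, Pi.add_apply, h2, h3]
  refine (abs_add_le _ _).trans_eq ?_
  simp [abs_mul, abs_of_nonneg ha, abs_of_nonneg hb]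

lemma continuous_l1Cost : Continuous (l1Cost : Signal T → ℝ) := by
  refine (LipschitzWith.of_le_add_mul ((horizon T).real univ).toNNReal fun u v ↦ ?_).continuous
  rw [Real.coe_toNNReal _ measureReal_nonneg]
  have h : l1Cost u - l1Cost v ≤ dist u v * (horizon T).real univ := by
    rw [l1Cost, l1Cost, ← integral_sub (integrable_signal u).abs (integrable_signal v).abs]
    refine (Real.le_norm_self _).trans (norm_integral_le_of_norm_le_const ?_)
    filter_upwards [ae_abs_le_norm (u - v), Lp.coeFn_sub u v] with t h1 h2
    rw [h2, Pi.sub_apply] at h1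
    rw [dist_eq_norm]
    exact (abs_abs_sub_abs_le_abs_sub _ _).trans h1
  linarith

/-! ### Pointwise maximum condition and Pontryagin's principle -/

/-- The maximizer of `w ↦ y w - c |w|` on `[-1, 1]`. -/
noncomputable def bangOffBang (c y : ℝ) : ℝ := if c < y then 1 else if y < -c then -1 else 0

lemma measurable_bangOffBang (c : ℝ) : Measurable (bangOffBang c) :=
  Measurable.ite measurableSet_Ioi measurable_const
    (Measurable.ite measurableSet_Iio measurable_const measurable_const)

lemma abs_bangOffBang_le (c y : ℝ) : |bangOffBang c y| ≤ 1 := by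
  unfold bangOffBang
  split_ifs <;> simp

lemma le_bangOffBang {c : ℝ} (hc : 0 ≤ c) (y : ℝ) {w : ℝ} (hw : |w| ≤ 1) :
    y * w - c * |w| ≤ y * bangOffBang c y - c * |bangOffBang c y| := by
  obtain ⟨hw1, hw2⟩ := abs_le.1 hw
  have h1 := le_abs_self w
  have h2 := neg_le_abs w
  have h0 := abs_nonneg w
  unfold bangOffBang
  split_ifs with h h'
  · simp only [abs_one]
    nlinarith
  · simp only [abs_neg, abs_one]
    nlinarith
  · simp only [abs_zero]
    rcases abs_cases w with ⟨h3, h4⟩ | ⟨h3, h4⟩ <;> rw [h3] <;> nlinarith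

/-- A control that maximizes `v ↦ ∫ (h v - c |v|)` on the unit ball maximizes the integrand at
almost every time. -/
lemma ae_maximizes {c : ℝ} (hc : 0 ≤ c) {h : ℝ → ℝ} (hh : Continuous h) {u : Signal T}
    (hu : ‖u‖ ≤ 1)
    (hmax : ∀ v : Signal T, ‖v‖ ≤ 1 →
      moment T hh v - c * l1Cost v ≤ moment T hh u - c * l1Cost u) :
    ∀ᵐ t ∂(horizon T), ∀ w : ℝ, |w| ≤ 1 → h t * w - c * |w| ≤ h t * u t - c * |u t| := by
  have hmem : MemLp (fun t ↦ bangOffBang c (h t)) ∞ (horizon T) :=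
    memLp_top_of_bound ((measurable_bangOffBang c).comp hh.measurable).aestronglyMeasurable 1
      (Filter.Eventually.of_forall fun t ↦ abs_bangOffBang_le c (h t))
  set v : Signal T := hmem.toLp
  have hv : ∀ᵐ t ∂(horizon T), v t = bangOffBang c (h t) := hmem.coeFn_toLp
  have hv1 : ‖v‖ ≤ 1 := by
    refine norm_le_one_of_ae ?_
    filter_upwards [hv] with t ht
    rw [ht]
    exact abs_bangOffBang_le c (h t)
  have hI (w : Signal T) : Integrable (fun t ↦ h t * w t - c * |w t|) (horizon T) :=
    (integrable_mul_signal hh w).sub ((integrable_signal w).abs.const_mul c)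
  have hE (w : Signal T) :
      moment T hh w - c * l1Cost w = ∫ t, (h t * w t - c * |w t|) ∂(horizon T) := by
    rw [integral_sub (integrable_mul_signal hh w) ((integrable_signal w).abs.const_mul c),
      integral_const_mul]
    rfl
  -- The gap to the pointwise maximizer is nonnegative, while optimality makes its integral
  -- nonpositive; so it vanishes a.e.
  have hnn : 0 ≤ᵐ[horizon T] fun t ↦ (h t * v t - c * |v t|) - (h t * u t - c * |u t|) := by
    filter_upwards [hv, ae_abs_le_norm u] with t ht hut
    rw [Pi.zero_apply, ht, sub_nonneg]
    exact le_bangOffBang hc _ (hut.trans hu)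
  have hzero : ∫ t, ((h t * v t - c * |v t|) - (h t * u t - c * |u t|)) ∂(horizon T) = 0 := by
    refine le_antisymm ?_ (integral_nonneg_of_ae hnn)
    rw [integral_sub (hI v) (hI u), ← hE, ← hE]
    exact sub_nonpos.2 (hmax v hv1)
  filter_upwards [hv, (integral_eq_zero_iff_of_nonneg_ae hnn ((hI v).sub (hI u))).1 hzero]
    with t ht h0 w hw
  rw [Pi.zero_apply, ht, sub_eq_zero] at h0
  rw [← h0]
  exact le_bangOffBang hc _ hw

/-- Pontryagin's minimum principle for `P₁`, with a multiplier `c` of the cost that may vanish. -/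
lemma exists_pontryagin {A : Matrix (Fin n) (Fin n) ℝ} {B ξ : Fin n → ℝ} (hT : 0 ≤ T)
    {u : Signal T} (hu : u ∈ l1Optimal A B T ξ) :
    ∃ (c : ℝ) (q : Fin n → ℝ), 0 ≤ c ∧ (c = 0 → ∃ t, switching A B q t ≠ 0) ∧
      ∀ᵐ t ∂(horizon T), ∀ w : ℝ, |w| ≤ 1 →
        switching A B q t * w - c * |w| ≤ switching A B q t * u t - c * |u t| := by
  set L : Fin n → Signal T →ₗ[ℝ] ℝ := fun i ↦ moment T (continuous_switching A B (Pi.single i 1))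
  have hL (q : Fin n → ℝ) (v : Signal T) :
      ∑ i, q i * L i v = moment T (continuous_switching A B q) v := by
    simp only [L, moment_apply, ← integral_const_mul]
    rw [← integral_finsetSum _ fun i _ ↦ (integrable_mul_signal
      (continuous_switching A B (Pi.single i 1)) v).const_mul (q i)]
    refine integral_congr_ae (Filter.Eventually.of_forall fun t ↦ ?_)
    simp only [switching_sum A B q t, Finset.sum_mul, mul_assoc]
  obtain ⟨c, q, hc, hc0, hq⟩ := exists_multiplier L convexOn_l1Cost continuous_l1Cost (u := u)
    fun v hv hLv ↦ l1Norm_le_iff.1 <| hu.2 v <| admissible_of_moments_eq hT hu.1 hv fun q ↦ by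
      rw [integral_horizon hT, integral_horizon hT,
        ← moment_apply (continuous_switching A B q), ← moment_apply (continuous_switching A B q),
        ← hL, ← hL]
      simp only [hLv]
  simp only [hL] at hc0 hq
  refine ⟨c, q, hc, fun h0 ↦ ?_, ae_maximizes hc (continuous_switching A B q) hu.1.1 hq⟩
  by_contra! hzero
  refine hc0 h0 ?_
  simp [moment_apply, hzero]

/-! ### Comparing support and L¹ norm -/

/-- The support carries the `L¹` norm of a control of norm at most one. -/
lemma l1Norm_le_l0Norm {u : Signal T} (hu : ‖u‖ ≤ 1) : l1Norm u ≤ l0Norm u := by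
  have hnull : volume {s | s ∈ Icc 0 T ∧ u s ≠ 0 ∧ s ∉ signalSupport u} = 0 := by
    refine measure_null_of_locally_null _ fun t ht ↦ ?_
    obtain ⟨htI, -, hts⟩ := ht
    simp only [signalSupport, mem_ofPred_eq, not_and, not_forall, not_lt,
      nonpos_iff_eq_zero] at hts
    obtain ⟨N, hN, hN0⟩ := hts htI
    refine ⟨_, Filter.inter_mem self_mem_nhdsWithin (mem_nhdsWithin_of_mem_nhds hN), ?_⟩
    refine measure_mono_null (fun s hs ↦ ?_) hN0
    exact ⟨hs.2, hs.1.1, hs.1.2.1⟩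
  have hae : ∀ᵐ t ∂(horizon T), u t ≠ 0 → t ∈ signalSupport u := by
    rw [ae_restrict_iff' measurableSet_Icc, ae_iff]
    refine measure_mono_null (fun s hs ↦ ?_) hnull
    simpa [and_assoc] using hs
  rw [l1Norm, eLpNorm_one_eq_lintegral_enorm]
  calc ∫⁻ t, ‖u t‖ₑ ∂(horizon T)
      ≤ ∫⁻ t, (signalSupport u).indicator 1 t ∂(horizon T) := by
        refine lintegral_mono_ae ?_
        filter_upwards [hae, ae_abs_le_norm u] with t ht hut
        by_cases h0 : u t = 0
        · simp [h0]
        · rw [indicator_of_mem (ht h0), Pi.one_apply, ← enorm_one (G := ℝ), enorm_le_iff_norm_le,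
            norm_one]
          exact hut.trans hu
    _ ≤ horizon T (signalSupport u) := lintegral_indicator_one_le _
    _ ≤ l0Norm u := Measure.restrict_apply_le _ _

/-- A control that vanishes where `|h| < 1` and has modulus one where `|h| > 1`, with `|h| = 1` on
a null set only, has support of measure at most its `L¹` norm. -/
lemma l0Norm_le_l1Norm {u : Signal T} {h : ℝ → ℝ} (hh : Continuous h)
    (hoff : ∀ᵐ t ∂(horizon T), |h t| < 1 → u t = 0)
    (hon : ∀ᵐ t ∂(horizon T), 1 < |h t| → 1 ≤ |u t|)
    (hnull : volume {t | t ∈ Icc 0 T ∧ |h t| = 1} = 0) : l0Norm u ≤ l1Norm u := by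
  set F : Set ℝ := {t | 1 ≤ |h t|}
  have hF : IsClosed F := isClosed_le continuous_const hh.abs
  -- Since `F` is closed, its complement is a neighbourhood of each of its points, and `u` vanishes
  -- a.e. there.
  have hsub : signalSupport u ⊆ F ∩ Icc 0 T := by
    rintro t ⟨htI, ht⟩
    refine ⟨?_, htI⟩
    by_contra htF
    refine (ht Fᶜ (hF.isOpen_compl.mem_nhds htF)).ne' ?_
    rw [ae_restrict_iff' measurableSet_Icc, ae_iff] at hoff
    refine measure_mono_null (fun s hs ↦ ?_) hoff
    have : |h s| < 1 := not_le.1 hs.1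
    simpa [this, and_assoc] using hs.2
  have hne : ∀ᵐ t ∂(horizon T), |h t| ≠ 1 := by
    rw [ae_restrict_iff' measurableSet_Icc, ae_iff]
    refine measure_mono_null (fun s hs ↦ ?_) hnull
    simpa [and_assoc] using hs
  rw [l1Norm, eLpNorm_one_eq_lintegral_enorm]
  calc l0Norm u ≤ volume (F ∩ Icc 0 T) := measure_mono hsub
    _ = ∫⁻ t, F.indicator 1 t ∂(horizon T) := by
        rw [lintegral_indicator_one hF.measurableSet, Measure.restrict_apply hF.measurableSet]
    _ ≤ ∫⁻ t, ‖u t‖ₑ ∂(horizon T) := by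
        refine lintegral_mono_ae ?_
        filter_upwards [hon, hne] with t h1 h2
        by_cases htF : t ∈ F
        · rw [indicator_of_mem htF, Pi.one_apply, ← enorm_one (G := ℝ), enorm_le_iff_norm_le,
            norm_one]
          exact h1 (lt_of_le_of_ne htF h2.symm)
        · simp [htF]

/-- Under normality, the support of an `L¹`-optimal control has measure at most its `L¹` norm. -/
lemma l0Norm_le_l1Norm_of_mem_l1Optimal {A : Matrix (Fin n) (Fin n) ℝ} {B ξ : Fin n → ℝ}
    (hT : 0 ≤ T) (hnormal : IsNormal A B T ξ) {u : Signal T} (hu : u ∈ l1Optimal A B T ξ) :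
    l0Norm u ≤ l1Norm u := by
  obtain ⟨c, q, hc, hc0, hmax⟩ := exists_pontryagin hT hu
  rcases hc.eq_or_lt with rfl | hcpos
  · obtain ⟨t₀, ht₀⟩ := hc0 rfl
    have hne : ∀ᵐ t ∂(horizon T), switching A B q t ≠ 0 :=
      ae_restrict_of_ae (ae_switching_ne_zero A B ht₀)
    -- Any constant above 1 makes all times "on"; only `1 ≤ |u t|` remains.
    refine l0Norm_le_l1Norm (h := fun _ ↦ 2) continuous_const (by simp) ?_ (by simp)
    filter_upwards [hne, hmax] with t ht hm _
    have h1 := hm 1 (by simp)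
    have h2 := hm (-1) (by simp)
    have h3 : |switching A B q t| ≤ |switching A B q t| * |u t| := by
      rw [← abs_mul]
      refine (abs_le.2 ⟨?_, ?_⟩).trans (le_abs_self _) <;> linarith
    exact le_of_mul_le_mul_left (by simpa using h3) (abs_pos.2 ht)
  · obtain ⟨⟨hu1, x, hx, hxT⟩, -⟩ := id hu
    set q' : Fin n → ℝ := -(c⁻¹ • q) with hq'
    have hsw (t : ℝ) : switching A B q t = -(c * switching A B q' t) := by
      have : q = -(c • q') := by
        rw [hq', smul_neg, neg_neg, smul_inv_smul₀ hcpos.ne']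
      rw [this]
      simp [switching, costate]
    have hmin : ∀ᵐ t ∂(horizon T), ∀ w : ℝ, |w| ≤ 1 →
        |u t| + switching A B q' t * u t ≤ |w| + switching A B q' t * w := by
      filter_upwards [hmax] with t ht w hw
      have := ht w hw
      rw [hsw] at this
      refine le_of_mul_le_mul_left ?_ hcpos
      linarith
    have hP : MinimumPrinciple A B ξ u x (costate A q') := by
      refine ⟨hx, hxT, fun t _ ↦ (hasDerivAt_costate A q' t).hasDerivWithinAt, ?_⟩
      filter_upwards [hmin] with t ht w hw
      have := ht w hw
      rw [switching, dotProduct_comm] at this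
      simp only [hamiltonian, dotProduct_add, dotProduct_smul, smul_eq_mul]
      linarith
    refine l0Norm_le_l1Norm (continuous_switching A B q') ?_ ?_ (hnormal u hu x _ hP)
    · filter_upwards [hmin] with t ht hlt
      have h0 := ht 0 (by simp)
      have h1 := neg_abs_le (switching A B q' t * u t)
      rw [abs_mul] at h1
      rw [abs_zero, mul_zero, add_zero] at h0
      have h2 : |u t| ≤ 0 := by nlinarith [abs_nonneg (u t)]
      exact abs_nonpos_iff.1 h2
    · filter_upwards [hmin] with t ht hlt
      have h1 := ht 1 (by simp)
      have h2 := ht (-1) (by simp)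
      have h3 := neg_abs_le (switching A B q' t * u t)
      rw [abs_mul] at h3
      simp only [abs_neg, abs_one, mul_one, mul_neg] at h1 h2
      rcases abs_cases (switching A B q' t) with ⟨h4, _⟩ | ⟨h4, _⟩ <;>
        rw [h4] at h3 hlt <;> nlinarith

end SparseControl

theorem theorem4p1 {n : ℕ} (A : Matrix (Fin n) (Fin n) ℝ) (B : Fin n → ℝ) (T : ℝ) (hT : 0 < T)
    (ξ : Fin n → ℝ) (hnormal : SparseControl.IsNormal A B T ξ)
    (hexists : (SparseControl.l1Optimal A B T ξ).Nonempty) :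
    SparseControl.sparseOptimal A B T ξ = SparseControl.l1Optimal A B T ξ ∧
      ∀ u₀ ∈ SparseControl.sparseOptimal A B T ξ, ∀ u₁ ∈ SparseControl.l1Optimal A B T ξ,
        SparseControl.l0Norm u₀ = SparseControl.l1Norm u₁ := by
  have hle {u : SparseControl.Signal T} (hu : u ∈ SparseControl.l1Optimal A B T ξ) :
      SparseControl.l0Norm u ≤ SparseControl.l1Norm u :=
    SparseControl.l0Norm_le_l1Norm_of_mem_l1Optimal hT.le hnormal hu
  have hge {u : SparseControl.Signal T} (hu : u ∈ SparseControl.admissible A B T ξ) :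
      SparseControl.l1Norm u ≤ SparseControl.l0Norm u :=
    SparseControl.l1Norm_le_l0Norm hu.1
  refine ⟨Set.Subset.antisymm (fun u hu ↦ ⟨hu.1, fun v hv ↦ ?_⟩)
    fun u hu ↦ ⟨hu.1, fun v hv ↦ (hle hu).trans ((hu.2 v hv).trans (hge hv))⟩,
    fun u₀ hu₀ u₁ hu₁ ↦ le_antisymm ((hu₀.2 u₁ hu₁.1).trans (hle hu₁))
      ((hu₁.2 u₀ hu₀.1).trans (hge hu₀.1))⟩
  -- An L¹ minimizer bridges the two costs, as both agree on it.
  obtain ⟨u₁, hu₁⟩ := hexists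
  exact (hge hu.1).trans ((hu.2 u₁ hu₁.1).trans ((hle hu₁).trans (hu₁.2 v hv)))
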